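/- Transfer functions are real-rational functions of $s$, i.e. elements of $\mathbb{R}(s)$. A transfer function is *stable* if all its poles lie in the open left half-plane. The result holds under both usual conventions on poles at infinity, one of which is fixed throughout: either only finite poles are counted, so that a stable transfer function may be improper, or a stable transfer function is also required to be proper. A transfer function matrix is stable if all its entries are. Let $n\ge 1$, and let $G_\wp\in\mathbb{R}(s)$ be strictly proper. Consider a platoon of $n$ identical follower vehicles with dynamics $G_\wp$ (that is, $G_k=\Phi_kG_\wp$ with $\Phi_k=1$ for all $k$) and constant inter-vehicle spacing (that is, $H(s)=1$). Its plant, from the controls $u$ to the spacing errors $z$ (entering the loop with a minus sign: $z=-G(u+w)+\nu$), is $G=G_\wp T$, where $T$ is the $n\times n$ matrix with $1$ on the diagonal, $-1$ on the first subdiagonal and $0$ elsewhere. A controller $K\in\mathbb{R}(s)^{n\times n}$, $u=Kz$, *stabilizes* $G$ if $I+GK$ is invertible and the closed-loop map from $(w,\nu)$ to $(z,u)$, $$\begin{bmatrix} T_{zw}&T_{z\nu}\\T_{uw}&T_{u\nu}\end{bmatrix}=\begin{bmatrix}-(I+GK)^{-1}G&(I+GK)^{-1}\\-K(I+GK)^{-1}G&K(I+GK)^{-1}\end{bmatrix},$$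 is stable. It is a *leader information controller* if moreover $(I+GK)^{-1}$ is diagonal. Write $J(K)=\|T_{zw}\|_2^2=\frac1{2\pi}\int_{-\infty}^{\infty}\mathrm{tr}\big(T_{zw}(i\omega)^*T_{zw}(i\omega)\big)\,d\omega\in[0,\infty]$. **Theorem.** Leader information controllers achieve global $\mathcal H_2$ optimality: 1. For every stabilizing controller $K$ there is a leader information controller $L$ with $J(L)\le J(K)$. Hence the infimum of $J$ over all stabilizing controllers equals its infimum over leader information controllers. The minimum of $J$ over all stabilizing controllers exists if and only if the minimum over leader information controllers does, and then the two minima are equal; so whenever the minimum over all stabilizing controllers exists, it is attained by a leader information controller. 2. Let $M_\wp,N_\wp,\tilde M_\wp,\tilde N_\wp,X_\wp,Y_\wp,\tilde X_\wp,\tilde Y_\wp$ be a doubly coprime factorization of $G_\wp$, i.e. stable transfer functions with $M_\wp,\tilde M_\wp\neq0$, $G_\wp=N_\wp/M_\wp=\tilde N_\wp/\tilde M_\wp$ and $$\begin{bmatrix}-\tilde N_\wp&\tilde M_\wp\\Y_\wp&X_\wp\end{bmatrix}\begin{bmatrix}-\tilde X_\wp&M_\wp\\\tilde Y_\wp&N_\wp\end{bmatrix}=I_2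 .$$ Then the matrices $$M=M_\wp T^{-1},\quad N=N_\wp I,\quad \tilde M=\tilde M_\wp I,\quad \tilde N=\tilde N_\wp T,\quad X=X_\wp I,\quad Y=Y_\wp T,\quad \tilde X=\tilde X_\wp T^{-1},\quad \tilde Y=\tilde Y_\wp I$$ form a doubly coprime factorization of $G$ (the same conditions, with $M,\tilde M$ invertible, $G=NM^{-1}=\tilde M^{-1}\tilde N$ and right-hand side $I_{2n}$). Relative to it, the controller with Youla parameter $Q$ is $K_Q=(Y-Q\tilde N)^{-1}(X+Q\tilde M)=(\tilde X+MQ)(\tilde Y-NQ)^{-1}$, where both inverted matrices are required to be invertible. Moreover: (a) For every stable $q\in\mathbb{R}(s)$ with $\tilde Y_\wp-N_\wp q\ne0$, the controller $K_Q$ with $Q=\mathrm{diag}(q,\dots,q)$ is defined and is a leader information controller. It minimizes $J$ over all stabilizing controllers if and only if $q$ solves the scalar $\mathcal H_2$ model-matching problem, i.e. minimizes $\|\tilde Y_\wp\tilde N_\wp-N_\wp q\tilde N_\wp\|_2^2$ over all stable $q$ with $\tilde Y_\wp-N_\wp q\neq0$. (b) For every stabilizing controller $K$ there is a stable $q$ such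 that $K_Q$ with $Q=\mathrm{diag}(q,\dots,q)$ is a leader information controller and $J(K_Q)\le J(K)$. (c) If the minimum of $J$ over all stabilizing controllers exists, then it is attained by a leader information controller $K_Q$ with $Q=\mathrm{diag}(Q_o^*,\dots,Q_o^*)$ for some stable $Q_o^*\in\mathbb{R}(s)$. -/

import Mathlib

open scoped ENNReal

/-! Real-rational transfer functions are elements of `RatFunc ℝ`, transfer function matrices are
matrices over this field. -/

/-- Every pole lies in the open left half-plane. -/
def IsStable (f : RatFunc ℝ) : Prop :=
  ∀ z : ℂ, Polynomial.aeval z f.denom = 0 → z.re < 0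

/-- No pole at infinity. -/
def IsProper (f : RatFunc ℝ) : Prop :=
  f.num.degree ≤ f.denom.degree

/-- The transfer function vanishes at infinity. -/
def IsStrictlyProper (f : RatFunc ℝ) : Prop :=
  f.num.degree < f.denom.degree

/-- Stable transfer functions, when only finite poles are counted. -/
def stableTF : Set (RatFunc ℝ) := {f | IsStable f}

/-- Stable transfer functions, when a pole at infinity is counted as a pole outside the open left
half-plane (that is, proper stable transfer functions). -/
def properStableTF : Set (RatFunc ℝ) := {f | IsStable f ∧ IsProper f}

/-- The squared `H₂` norm `(1 / 2π) ∫ tr (A(iω)ᴴ A(iω)) dω`, with value `∞` if the integral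
diverges. -/
noncomputable def h2NormSq {p q : Type*} [Fintype p] [Fintype q]
    (A : Matrix p q (RatFunc ℝ)) : ℝ≥0∞ :=
  ENNReal.ofReal (1 / (2 * Real.pi)) *
    ∫⁻ ω : ℝ, ∑ i, ∑ j,
      ‖RatFunc.eval (algebraMap ℝ ℂ) ((ω : ℂ) * Complex.I) (A i j)‖ₑ ^ 2

section ClosedLoop

variable {n : ℕ}

/-- The closed-loop map `-(I + G K)⁻¹ G` from the disturbances `w` to the errors `z`. -/
noncomputable def Tzw (G K : Matrix (Fin n) (Fin n) (RatFunc ℝ)) :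
    Matrix (Fin n) (Fin n) (RatFunc ℝ) :=
  -((1 + G * K)⁻¹ * G)

/-- The closed-loop transfer function matrix `H(G, K)` of the unity feedback loop, from `(w, ν)` to
`(z, u)`. -/
noncomputable def closedLoop (G K : Matrix (Fin n) (Fin n) (RatFunc ℝ)) :
    Matrix (Fin n ⊕ Fin n) (Fin n ⊕ Fin n) (RatFunc ℝ) :=
  Matrix.fromBlocks
    (Tzw G K) ((1 + G * K)⁻¹)
    (-(K * (1 + G * K)⁻¹ * G)) (K * (1 + G * K)⁻¹)

/-- `K` stabilizes `G`: the loop is well posed and every entry of `H(G, K)` is in the set `S` of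
stable transfer functions. -/
def Stabilizes (S : Set (RatFunc ℝ)) (G K : Matrix (Fin n) (Fin n) (RatFunc ℝ)) : Prop :=
  IsUnit (1 + G * K) ∧ ∀ i j, closedLoop G K i j ∈ S

/-- A leader information controller: a stabilizing `K` for which `(I + G K)⁻¹` is diagonal. -/
def IsLeaderInformation (S : Set (RatFunc ℝ)) (G K : Matrix (Fin n) (Fin n) (RatFunc ℝ)) : Prop :=
  Stabilizes S G K ∧ ((1 + G * K)⁻¹).IsDiag

end ClosedLoop

section Factorizations

/-- Eight factors `M, N, M̃, Ñ, X, Y, X̃, Ỹ`, scalars or square matrices. -/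
structure Factors (R : Type*) where
  M : R
  N : R
  Mt : R
  Nt : R
  X : R
  Y : R
  Xt : R
  Yt : R

/-- The eight factors, all satisfying the stability predicate `P`, form a doubly coprime
factorization of `G`: `M` and `M̃` are invertible, `G = N M⁻¹ = M̃⁻¹ Ñ`, and the Bézout identity
holds (as an identity of `2 × 2` block matrices). -/
structure Factors.IsDoublyCoprime {R : Type*} [Ring R] (F : Factors R) (P : R → Prop) (G : R) :
    Prop where
  stable_M : P F.M
  stable_N : P F.N
  stable_Mt : P F.Mt
  stable_Nt : P F.Nt
  stable_X : P F.X
  stable_Y : P F.Y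
  stable_Xt : P F.Xt
  stable_Yt : P F.Yt
  isUnit_M : IsUnit F.M
  isUnit_Mt : IsUnit F.Mt
  right_fac : G * F.M = F.N
  left_fac : F.Mt * G = F.Nt
  bezout : !![-F.Nt, F.Mt; F.Y, F.X] * !![-F.Xt, F.M; F.Yt, F.N] = 1

variable {n : ℕ}

/-- `K` is the controller `K_Q = Y_Q⁻¹ X_Q = X̃_Q Ỹ_Q⁻¹` with Youla parameter `Q`, relative to the
factors `F`. -/
def Factors.IsYoulaController (F : Factors (Matrix (Fin n) (Fin n) (RatFunc ℝ)))
    (Q K : Matrix (Fin n) (Fin n) (RatFunc ℝ)) : Prop :=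
  IsUnit (F.Y - Q * F.Nt) ∧ IsUnit (F.Yt - F.N * Q) ∧
    K = (F.Y - Q * F.Nt)⁻¹ * (F.X + Q * F.Mt) ∧
    K = (F.Xt + F.M * Q) * (F.Yt - F.N * Q)⁻¹

end Factorizations

section Platoon

/-- `H(s) = h s + 1`; `h = 0` is the constant spacing policy. -/
noncomputable def headway (h : ℝ) : RatFunc ℝ := RatFunc.C h * RatFunc.X + 1

/-- The lower bidiagonal matrix `T`, with `H` on the diagonal and `-1` below it. -/
noncomputable def platoonT (n : ℕ) (h : ℝ) : Matrix (Fin n) (Fin n) (RatFunc ℝ) :=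
  Matrix.of fun i j => if i = j then headway h else if (i : ℕ) = (j : ℕ) + 1 then -1 else 0

/-- The platoon's plant `G = T · diag(G₁, …, Gₙ)` for vehicles `G_k = Φ_k G_℘`. -/
noncomputable def platoonPlant (n : ℕ) (h : ℝ) (Φ : Fin n → RatFunc ℝ) (Gp : RatFunc ℝ) :
    Matrix (Fin n) (Fin n) (RatFunc ℝ) :=
  platoonT n h * Matrix.diagonal fun k => Φ k * Gp

/-- The factors of the platoon's plant built from scalar factors `F` of `G_℘`. -/
noncomputable def platoonFactors (n : ℕ) (h : ℝ) (Φ : Fin n → RatFunc ℝ)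
    (F : Factors (RatFunc ℝ)) : Factors (Matrix (Fin n) (Fin n) (RatFunc ℝ)) where
  M := (headway h * F.M) • ((Matrix.diagonal Φ)⁻¹ * (platoonT n h)⁻¹)
  N := (headway h * F.N) • 1
  Mt := F.Mt • 1
  Nt := F.Nt • (platoonT n h * Matrix.diagonal Φ)
  X := (F.X * (headway h)⁻¹) • 1
  Y := (F.Y * (headway h)⁻¹) • (platoonT n h * Matrix.diagonal Φ)
  Xt := F.Xt • ((Matrix.diagonal Φ)⁻¹ * (platoonT n h)⁻¹)
  Yt := F.Yt • 1

/-- The cost of the scalar model-matching problem, `‖Ỹ Ñ - N q Ñ‖₂²`. -/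
noncomputable def scalarCost (F : Factors (RatFunc ℝ)) (q : RatFunc ℝ) : ℝ≥0∞ :=
  h2NormSq (Matrix.of fun _ _ : Fin 1 => F.Yt * F.Nt - F.N * q * F.Nt)

end Platoon

/-! ### The ring of stable transfer functions -/

/-! Write `R = K(I+GK)⁻¹` with `G = Gp • T`. Then `T_zw = -Gp(T - Gp·TRT)`, so each entry of `T_zw`
is affine in the matching entry of `TRT`, with the same scalar coefficients everywhere. At a
position where `T` has the entry `a = ±1`, the factor `a` can be pulled out, and the entry becomes
`-a·Gp(1 - Gp r)` with `r = a(TRT)ᵢⱼ`. Stability of the closed loop makes `r`, `Gp r` and `Gp(1 - Gp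
r)` stable. Thus every nonzero position of `T` carries a stable scalar loop around `Gp`
(`Stabilizes.exists_isLoopParameter`).

Conversely, such an `r` gives the controller `r/(1 - Gp r)·T⁻¹`. It cancels `T` and decouples the
loop; its `T_zw` is `-Gp(1 - Gp r)·T`, and its cost is the number of nonzero entries of `T` times
one scalar cost. Using the `r` of the cheapest nonzero position replaces every entry there by the
cheapest one and every other entry by zero, so the cost does not increase
(`Stabilizes.exists_leaderController_le`).

One degenerate case remains: if `1 - Gp r = 0`, the new controller is undefined. The original cost
is then still positive, because `T_zw` is invertible, so a small perturbation of `r` restores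
well-posedness within the budget (`IsLoopParameter.exists_perturbation`).

For the Youla statements, a doubly coprime factorization of `Gp` parametrizes the admissible `r`
exactly as `(Xt + M q)Mt` with `q` stable. Under this substitution the scalar cost is the
model-matching cost, and the decoupling controller is `K_Q` with `Q = diag(q, …, q)`. -/

theorem IsStable.of_denom_dvd_mul {f g h : RatFunc ℝ} (hf : IsStable f) (hg : IsStable g)
    (hd : h.denom ∣ f.denom * g.denom) : IsStable h := by
  intro z hz
  obtain ⟨c, hc⟩ := hd
  have h0 : Polynomial.aeval z (f.denom * g.denom) = 0 := by rw [hc, map_mul, hz, zero_mul]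
  rw [map_mul, mul_eq_zero] at h0
  exact h0.elim (hf z) (hg z)

theorem isStable_C (c : ℝ) : IsStable (RatFunc.C c) := by
  intro z hz
  simp at hz

theorem isProper_C (c : ℝ) : IsProper (RatFunc.C c) := by
  simp only [IsProper, RatFunc.num_C, RatFunc.denom_C, Polynomial.degree_one]
  exact Polynomial.degree_C_le

/-- Lets properness be read off an unreduced fraction `p / q`, which is the form in which sums and
products arrive. -/
theorem isProper_of_eq_div {f : RatFunc ℝ} {p q : Polynomial ℝ} (hq : q ≠ 0)
    (h : f.num * q = p * f.denom) (hd : p.degree ≤ q.degree) : IsProper f := by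
  have h1 : f.num.degree + q.degree ≤ f.denom.degree + q.degree := by
    rw [← Polynomial.degree_mul, h, Polynomial.degree_mul, add_comm]
    gcongr
  exact (WithBot.add_le_add_iff_right (Polynomial.degree_ne_bot.2 hq)).1 h1

theorem IsProper.mul {f g : RatFunc ℝ} (hf : IsProper f) (hg : IsProper g) :
    IsProper (f * g) := by
  refine isProper_of_eq_div (mul_ne_zero f.denom_ne_zero g.denom_ne_zero)
    (RatFunc.num_denom_mul f g) ?_
  rw [Polynomial.degree_mul, Polynomial.degree_mul]
  exact add_le_add hf hg

theorem IsProper.add {f g : RatFunc ℝ} (hf : IsProper f) (hg : IsProper g) :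
    IsProper (f + g) := by
  refine isProper_of_eq_div (mul_ne_zero f.denom_ne_zero g.denom_ne_zero)
    (RatFunc.num_denom_add f g) ((Polynomial.degree_add_le _ _).trans (max_le ?_ ?_)) <;>
  rw [Polynomial.degree_mul, Polynomial.degree_mul]
  · exact add_le_add hf le_rfl
  · exact add_le_add le_rfl hg

/-- The stable transfer functions form a ring that contains the constants and `1 / (s + 1)`,
under either convention on poles at infinity. -/
theorem exists_subring_of_stable {S : Set (RatFunc ℝ)} (hS : S = stableTF ∨ S = properStableTF) :
    ∃ A : Subring (RatFunc ℝ), (A : Set (RatFunc ℝ)) = S ∧ (∀ f ∈ A, IsStable f) ∧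
      (∀ c, RatFunc.C c ∈ A) ∧ (RatFunc.X + 1 : RatFunc ℝ)⁻¹ ∈ A := by
  have hadd : ∀ {f g : RatFunc ℝ}, IsStable f → IsStable g → IsStable (f + g) :=
    fun hf hg => hf.of_denom_dvd_mul hg (RatFunc.denom_add_dvd _ _)
  have hmul : ∀ {f g : RatFunc ℝ}, IsStable f → IsStable g → IsStable (f * g) :=
    fun hf hg => hf.of_denom_dvd_mul hg (RatFunc.denom_mul_dvd _ _)
  have hneg (f : RatFunc ℝ) : -f = RatFunc.C (-1) * f := by simp
  have h0 : (0 : RatFunc ℝ) = RatFunc.C 0 := by simp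
  have h1 : (1 : RatFunc ℝ) = RatFunc.C 1 := by simp
  have hq : (Polynomial.X + 1 : Polynomial ℝ) ≠ 0 := Polynomial.X_add_C_ne_zero 1
  have hinv : (RatFunc.X + 1 : RatFunc ℝ)⁻¹ =
      algebraMap _ _ (1 : Polynomial ℝ) / algebraMap _ _ (Polynomial.X + 1 : Polynomial ℝ) := by
    simp [RatFunc.algebraMap_X]
  have hst : IsStable (RatFunc.X + 1)⁻¹ := by
    intro z hz
    have hd := RatFunc.denom_div_dvd (1 : Polynomial ℝ) (Polynomial.X + 1)
    rw [← hinv] at hd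
    obtain ⟨c, hc⟩ := hd
    have h2 : Polynomial.aeval z (Polynomial.X + 1 : Polynomial ℝ) = 0 := by
      rw [hc, map_mul, hz, zero_mul]
    simp only [map_add, Polynomial.aeval_X, map_one] at h2
    rw [eq_neg_of_add_eq_zero_left h2]
    simp
  have hpr : IsProper (RatFunc.X + 1)⁻¹ := by
    refine isProper_of_eq_div hq ((RatFunc.num_mul_eq_mul_denom_iff hq).2 hinv) ?_
    rw [show (Polynomial.X + 1 : Polynomial ℝ) = Polynomial.X + Polynomial.C 1 by simp,
      Polynomial.degree_X_add_C, Polynomial.degree_one]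
    exact zero_le_one
  rcases hS with rfl | rfl
  · refine ⟨{
      carrier := stableTF
      mul_mem' := hmul
      add_mem' := hadd
      one_mem' := ?_
      zero_mem' := ?_
      neg_mem' := ?_ }, rfl, fun f hf => hf, isStable_C, hst⟩
    · rw [h1]; exact isStable_C 1
    · rw [h0]; exact isStable_C 0
    · intro f hf
      rw [hneg]; exact hmul (isStable_C _) hf
  · refine ⟨{
      carrier := properStableTF
      mul_mem' := fun hf hg => ⟨hmul hf.1 hg.1, hf.2.mul hg.2⟩
      add_mem' := fun hf hg => ⟨hadd hf.1 hg.1, hf.2.add hg.2⟩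
      one_mem' := ?_
      zero_mem' := ?_
      neg_mem' := ?_ }, rfl, fun f hf => hf.1, fun c => ⟨isStable_C c, isProper_C c⟩, hst, hpr⟩
    · rw [h1]; exact ⟨isStable_C 1, isProper_C 1⟩
    · rw [h0]; exact ⟨isStable_C 0, isProper_C 0⟩
    · intro f hf
      rw [hneg]; exact ⟨hmul (isStable_C _) hf.1, (isProper_C _).mul hf.2⟩

/-! ### The squared `H₂` norm -/

/-- The squared `H₂` norm of a scalar transfer function. -/
noncomputable def scalarH2 (f : RatFunc ℝ) : ℝ≥0∞ := h2NormSq (Matrix.of fun _ _ : Fin 1 => f)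

theorem scalarH2_def (f : RatFunc ℝ) : scalarH2 f = ENNReal.ofReal (1 / (2 * Real.pi)) *
    ∫⁻ ω : ℝ, ‖RatFunc.eval (algebraMap ℝ ℂ) ((ω : ℂ) * Complex.I) f‖ₑ ^ 2 := by
  simp [scalarH2, h2NormSq]

theorem measurable_eval_imaginary_axis (f : RatFunc ℝ) :
    Measurable fun ω : ℝ => RatFunc.eval (algebraMap ℝ ℂ) ((ω : ℂ) * Complex.I) f := by
  have h (p : Polynomial ℝ) :
      Measurable fun ω : ℝ => Polynomial.eval₂ (algebraMap ℝ ℂ) ((ω : ℂ) * Complex.I) p := by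
    simp_rw [← Polynomial.aeval_def]
    exact Continuous.measurable (by fun_prop)
  exact (h _).div (h _)

/-- The cost splits over entries, so that entries of `T_zw` can be compared and discarded one at a
time. -/
theorem h2NormSq_eq_sum {p q : Type*} [Fintype p] [Fintype q] (A : Matrix p q (RatFunc ℝ)) :
    h2NormSq A = ∑ i, ∑ j, scalarH2 (A i j) := by
  have h (f : RatFunc ℝ) : Measurable fun ω : ℝ =>
      ‖RatFunc.eval (algebraMap ℝ ℂ) ((ω : ℂ) * Complex.I) f‖ₑ ^ 2 :=
    (measurable_eval_imaginary_axis f).enorm.pow_const 2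
  have key (B : p → q → RatFunc ℝ) :
      ∫⁻ ω : ℝ, ∑ i, ∑ j,
        ‖RatFunc.eval (algebraMap ℝ ℂ) ((ω : ℂ) * Complex.I) (B i j)‖ₑ ^ 2 =
      ∑ i, ∑ j, ∫⁻ ω : ℝ,
        ‖RatFunc.eval (algebraMap ℝ ℂ) ((ω : ℂ) * Complex.I) (B i j)‖ₑ ^ 2 := by
    rw [MeasureTheory.lintegral_finsetSum _
      fun i _ => Finset.measurable_fun_sum _ fun j _ => h _]
    simp_rw [MeasureTheory.lintegral_finsetSum _ fun j _ => h _]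
  simp_rw [scalarH2_def, ← Finset.mul_sum]
  exact congrArg _ (key A)

@[simp]
theorem scalarH2_zero : scalarH2 0 = 0 := by simp [scalarH2_def]

/-- Stability excludes poles on the imaginary axis. This is needed because `RatFunc.eval` divides by
the reduced denominator, with value `0` at poles, and so respects products only away from them. -/
theorem IsStable.eval₂_denom_ne_zero {f : RatFunc ℝ} (hf : IsStable f) (ω : ℝ) :
    Polynomial.eval₂ (algebraMap ℝ ℂ) ((ω : ℂ) * Complex.I) f.denom ≠ 0 := by
  intro h
  simpa using hf _ h

theorem scalarH2_C_mul {f : RatFunc ℝ} (hf : IsStable f) (c : ℝ) :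
    scalarH2 (RatFunc.C c * f) = ‖c‖ₑ ^ 2 * scalarH2 f := by
  have h (ω : ℝ) : ‖RatFunc.eval (algebraMap ℝ ℂ) ((ω : ℂ) * Complex.I) (RatFunc.C c * f)‖ₑ ^ 2 =
      ‖c‖ₑ ^ 2 * ‖RatFunc.eval (algebraMap ℝ ℂ) ((ω : ℂ) * Complex.I) f‖ₑ ^ 2 := by
    rw [RatFunc.eval_mul _ _ ((isStable_C c).eval₂_denom_ne_zero ω) (hf.eval₂_denom_ne_zero ω),
      RatFunc.eval_C, enorm_mul, mul_pow]
    congr 2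
    simp [enorm_eq_nnnorm]
  simp_rw [scalarH2_def, h]
  rw [MeasureTheory.lintegral_const_mul' _ _ (by simp), mul_left_comm]

theorem scalarH2_neg {f : RatFunc ℝ} (hf : IsStable f) : scalarH2 (-f) = scalarH2 f := by
  have := scalarH2_C_mul hf (-1)
  simpa using this

/-- The evaluation vanishes only at roots of the numerator or, by the convention `x / 0 = 0`, at
poles. Both sets are finite, hence null. -/
theorem scalarH2_ne_zero {f : RatFunc ℝ} (hf : f ≠ 0) : scalarH2 f ≠ 0 := by
  have hfin (p : Polynomial ℝ) (hp : p ≠ 0) :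
      {ω : ℝ | Polynomial.eval₂ (algebraMap ℝ ℂ) ((ω : ℂ) * Complex.I) p = 0}.Finite := by
    refine Set.Finite.subset (Set.Finite.preimage (f := fun ω : ℝ => (ω : ℂ) * Complex.I)
      ?_ (Polynomial.rootSet_finite p ℂ)) ?_
    · intro x _ y _ h
      simpa using h
    · intro ω hω
      exact (Polynomial.mem_rootSet_of_ne hp).2 hω
  rw [scalarH2_def]
  refine mul_ne_zero (by simp [Real.pi_pos]) fun h => ?_
  rw [MeasureTheory.lintegral_eq_zero_iff
    ((measurable_eval_imaginary_axis f).enorm.pow_const 2)] at h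
  have h1 := (hfin f.num (RatFunc.num_ne_zero hf)).measure_zero MeasureTheory.volume
  have h2 := (hfin f.denom f.denom_ne_zero).measure_zero MeasureTheory.volume
  rw [MeasureTheory.measure_eq_zero_iff_ae_notMem] at h1 h2
  obtain ⟨ω, hω, h1, h2⟩ := (h.and (h1.and h2)).exists
  simp only [Pi.zero_apply, pow_eq_zero_iff, ne_eq, OfNat.ofNat_ne_zero, not_false_eq_true,
    enorm_eq_zero, RatFunc.eval, div_eq_zero_iff] at hω
  exact hω.elim h1 h2

/-- On the imaginary axis the squared modulus is `1 / (1 + ω²)`, which is integrable. This function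
serves as the direction of perturbation when a loop is ill posed. -/
theorem scalarH2_inv_X_add_one_ne_top (h : IsStable (RatFunc.X + 1)⁻¹) :
    scalarH2 (RatFunc.X + 1)⁻¹ ≠ ∞ := by
  have hX : (RatFunc.X + 1 : RatFunc ℝ) = algebraMap (Polynomial ℝ) _ (Polynomial.X + 1) := by
    simp [RatFunc.algebraMap_X]
  have hne : (RatFunc.X + 1 : RatFunc ℝ) ≠ 0 := by
    rw [hX]
    exact RatFunc.algebraMap_ne_zero (Polynomial.X_add_C_ne_zero 1)
  have hev (ω : ℝ) :
      ‖RatFunc.eval (algebraMap ℝ ℂ) ((ω : ℂ) * Complex.I) (RatFunc.X + 1)⁻¹‖ₑ ^ 2 =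
        ENNReal.ofReal (1 + ω ^ 2)⁻¹ := by
    have h1 := RatFunc.eval_mul (algebraMap ℝ ℂ) ((ω : ℂ) * Complex.I)
      (x := (RatFunc.X + 1)⁻¹) (y := RatFunc.X + 1) (h.eval₂_denom_ne_zero ω)
      (by rw [hX, RatFunc.denom_algebraMap]; simp)
    rw [inv_mul_cancel₀ hne, RatFunc.eval_one, hX, RatFunc.eval_algebraMap, ← hX] at h1
    rw [eq_inv_of_mul_eq_one_left h1.symm, ← ofReal_norm, ← ENNReal.ofReal_pow (norm_nonneg _),
      norm_inv, inv_pow, ← Complex.normSq_eq_norm_sq]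
    simp [Complex.normSq_apply, sq]
  rw [scalarH2_def]
  simp_rw [hev]
  exact ENNReal.mul_ne_top (by simp) integrable_inv_one_add_sq.lintegral_lt_top.ne

/-! ### The platoon's matrix -/

theorem headway_zero : headway 0 = 1 := by simp [headway]

theorem platoonT_zero_apply (n : ℕ) (i j : Fin n) : platoonT n 0 i j =
    if i = j then 1 else if (i : ℕ) = (j : ℕ) + 1 then -1 else 0 := by
  simp [platoonT, headway_zero]

theorem platoonT_zero_mul_self_of_ne_zero {n : ℕ} {i j : Fin n} (h : platoonT n 0 i j ≠ 0) :
    platoonT n 0 i j * platoonT n 0 i j = 1 := by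
  rw [platoonT_zero_apply] at h ⊢
  split_ifs at h ⊢ <;> simp_all

/-- The platoon's matrix and its inverse have constant entries. -/
theorem exists_real_platoonT (n : ℕ) : ∃ T₀ T₁ : Matrix (Fin n) (Fin n) ℝ,
    platoonT n 0 = T₀.map RatFunc.C ∧ platoonT n 0 * T₁.map RatFunc.C = 1 := by
  let T₀ : Matrix (Fin n) (Fin n) ℝ :=
    Matrix.of fun i j => if i = j then 1 else if (i : ℕ) = (j : ℕ) + 1 then -1 else 0
  have h : platoonT n 0 = T₀.map RatFunc.C := by
    ext i j
    rw [platoonT_zero_apply, Matrix.map_apply]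
    simp only [T₀, Matrix.of_apply]
    split_ifs <;> simp
  have hdet : T₀.det = 1 := by
    rw [Matrix.det_of_isLowerTriangular]
    · simp [T₀]
    · intro i j hij
      have : i < j := hij
      have h1 : i ≠ j := this.ne
      have h2 : (i : ℕ) ≠ (j : ℕ) + 1 := by have : (i : ℕ) < j := this; omega
      simp [T₀, h1, h2]
  refine ⟨T₀, T₀⁻¹, h, ?_⟩
  rw [h, ← Matrix.map_mul, Matrix.mul_nonsing_inv _ (by simp [hdet])]
  simp

theorem isUnit_platoonT_zero (n : ℕ) : IsUnit (platoonT n 0) := by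
  obtain ⟨_, T₁, _, h⟩ := exists_real_platoonT n
  exact IsUnit.of_mul_eq_one _ h

theorem platoonT_zero_mul_inv (n : ℕ) : platoonT n 0 * (platoonT n 0)⁻¹ = 1 :=
  Matrix.mul_nonsing_inv _ ((Matrix.isUnit_iff_isUnit_det _).1 (isUnit_platoonT_zero n))

theorem platoonT_zero_inv_mul (n : ℕ) : (platoonT n 0)⁻¹ * platoonT n 0 = 1 :=
  Matrix.nonsing_inv_mul _ ((Matrix.isUnit_iff_isUnit_det _).1 (isUnit_platoonT_zero n))

theorem platoonPlant_zero_one (n : ℕ) (Gp : RatFunc ℝ) :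
    platoonPlant n 0 (fun _ => 1) Gp = Gp • platoonT n 0 := by
  simp [platoonPlant, ← Matrix.smul_eq_mul_diagonal]

theorem platoonFactors_zero_one (n : ℕ) (F : Factors (RatFunc ℝ)) :
    platoonFactors n 0 (fun _ => 1) F =
      { M := F.M • (platoonT n 0)⁻¹
        N := F.N • 1
        Mt := F.Mt • 1
        Nt := F.Nt • platoonT n 0
        X := F.X • 1
        Y := F.Y • platoonT n 0
        Xt := F.Xt • (platoonT n 0)⁻¹
        Yt := F.Yt • 1 } := by
  simp [platoonFactors, headway_zero]

theorem platoonT_zero_mem {A : Subring (RatFunc ℝ)} (hC : ∀ c, RatFunc.C c ∈ A) (n : ℕ) :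
    platoonT n 0 ∈ A.matrix := by
  obtain ⟨T₀, T₁, h, _⟩ := exists_real_platoonT n
  rw [h]
  exact fun i j => hC _

theorem platoonT_zero_inv_mem {A : Subring (RatFunc ℝ)} (hC : ∀ c, RatFunc.C c ∈ A) (n : ℕ) :
    (platoonT n 0)⁻¹ ∈ A.matrix := by
  obtain ⟨T₀, T₁, _, h⟩ := exists_real_platoonT n
  rw [Matrix.inv_eq_right_inv h]
  exact fun i j => hC _

/-! ### Scalar parameters of stabilizing controllers -/

/-- Stability of the closed loop of `Gp` with a controller `k` for which `r = k / (1 + Gp k)`. -/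
structure IsLoopParameter (A : Subring (RatFunc ℝ)) (Gp r : RatFunc ℝ) : Prop where
  mem : r ∈ A
  mul_mem : Gp * r ∈ A
  mul_one_sub_mem : Gp * (1 - Gp * r) ∈ A

/-- The leader information controller with scalar parameter `r`. -/
noncomputable def leaderController (n : ℕ) (Gp r : RatFunc ℝ) :
    Matrix (Fin n) (Fin n) (RatFunc ℝ) :=
  (r / (1 - Gp * r)) • (platoonT n 0)⁻¹

section Leader

variable {n : ℕ} {Gp r : RatFunc ℝ}

/-- The factor `T⁻¹` of the controller cancels the `T` of the plant, so the loop gain is the scalar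
matrix `Gp r / (1 - Gp r) · I`. -/
theorem one_add_mul_leaderController (hs : 1 - Gp * r ≠ 0) :
    1 + (Gp • platoonT n 0) * leaderController n Gp r =
      (1 - Gp * r)⁻¹ • (1 : Matrix (Fin n) (Fin n) (RatFunc ℝ)) := by
  rw [leaderController, Matrix.smul_mul, Matrix.mul_smul, platoonT_zero_mul_inv, smul_smul]
  nth_rw 1 [← one_smul (RatFunc ℝ) (1 : Matrix (Fin n) (Fin n) (RatFunc ℝ))]
  rw [← add_smul]
  congr 1
  field_simp
  ring

theorem inv_one_add_mul_leaderController (hs : 1 - Gp * r ≠ 0) :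
    (1 + (Gp • platoonT n 0) * leaderController n Gp r)⁻¹ =
      (1 - Gp * r) • (1 : Matrix (Fin n) (Fin n) (RatFunc ℝ)) := by
  rw [one_add_mul_leaderController hs]
  apply Matrix.inv_eq_right_inv
  rw [Matrix.smul_mul, Matrix.mul_smul, smul_smul, inv_mul_cancel₀ hs, one_smul, one_mul]

theorem Tzw_leaderController (hs : 1 - Gp * r ≠ 0) :
    Tzw (Gp • platoonT n 0) (leaderController n Gp r) =
      -((Gp * (1 - Gp * r)) • platoonT n 0) := by
  rw [Tzw, inv_one_add_mul_leaderController hs, Matrix.smul_mul, one_mul, smul_smul, mul_comm]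

theorem IsLoopParameter.isLeaderInformation {A : Subring (RatFunc ℝ)}
    (hC : ∀ c, RatFunc.C c ∈ A) (h : IsLoopParameter A Gp r) (hs : 1 - Gp * r ≠ 0) :
    IsLeaderInformation A (Gp • platoonT n 0) (leaderController n Gp r) := by
  have hsmul {a : RatFunc ℝ} (ha : a ∈ A) {B : Matrix (Fin n) (Fin n) (RatFunc ℝ)}
      (hB : B ∈ A.matrix) : a • B ∈ A.matrix := fun i j => A.mul_mem ha (hB i j)
  have hT := platoonT_zero_mem hC n
  have hT' := platoonT_zero_inv_mem hC n
  have hr : leaderController n Gp r * ((1 - Gp * r) • 1) = r • (platoonT n 0)⁻¹ := by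
    rw [leaderController, Matrix.mul_smul, mul_one, smul_smul, mul_div_cancel₀ _ hs]
  refine ⟨⟨?_, ?_⟩, ?_⟩
  · rw [one_add_mul_leaderController hs]
    exact (isUnit_one.smul (Units.mk0 _ (inv_ne_zero hs)))
  · have h1 : Tzw (Gp • platoonT n 0) (leaderController n Gp r) ∈ A.matrix := by
      rw [Tzw_leaderController hs]
      exact neg_mem (hsmul h.mul_one_sub_mem hT)
    have h2 : (1 - Gp * r) • (1 : Matrix (Fin n) (Fin n) (RatFunc ℝ)) ∈ A.matrix :=
      hsmul (A.sub_mem A.one_mem h.mul_mem) (one_mem _)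
    have h3 : -(r • (platoonT n 0)⁻¹ * (Gp • platoonT n 0)) ∈ A.matrix := by
      rw [Matrix.smul_mul, Matrix.mul_smul, platoonT_zero_inv_mul, smul_smul, mul_comm]
      exact neg_mem (hsmul h.mul_mem (one_mem _))
    rw [closedLoop, inv_one_add_mul_leaderController hs, hr]
    rintro (i | i) (j | j)
    · exact h1 i j
    · exact h2 i j
    · exact h3 i j
    · exact hsmul h.mem hT' i j
  · rw [inv_one_add_mul_leaderController hs]
    exact Matrix.isDiag_smul_one _ _

open Classical in
/-- The positions of the nonzero entries of the platoon's matrix. -/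
noncomputable def platoonSupport (n : ℕ) : Finset (Fin n × Fin n) :=
  Finset.univ.filter fun p => platoonT n 0 p.1 p.2 ≠ 0

theorem mem_platoonSupport {p : Fin n × Fin n} :
    p ∈ platoonSupport n ↔ platoonT n 0 p.1 p.2 ≠ 0 := by
  simp [platoonSupport]

theorem platoonSupport_nonempty (hn : 1 ≤ n) : (platoonSupport n).Nonempty :=
  ⟨(⟨0, hn⟩, ⟨0, hn⟩), by simp [mem_platoonSupport, platoonT_zero_apply]⟩

theorem sum_platoonSupport_le (B : Matrix (Fin n) (Fin n) (RatFunc ℝ)) :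
    ∑ p ∈ platoonSupport n, scalarH2 (B p.1 p.2) ≤ h2NormSq B := by
  rw [h2NormSq_eq_sum, ← Fintype.sum_prod_type']
  exact Finset.sum_le_sum_of_subset (Finset.subset_univ _)

/-- The nonzero entries of `T` are `±1`, and each contributes the same scalar cost. -/
theorem h2NormSq_Tzw_leaderController {A : Subring (RatFunc ℝ)} (hA : ∀ f ∈ A, IsStable f)
    (h : IsLoopParameter A Gp r) (hs : 1 - Gp * r ≠ 0) :
    h2NormSq (Tzw (Gp • platoonT n 0) (leaderController n Gp r)) =
      (platoonSupport n).card * scalarH2 (Gp * (1 - Gp * r)) := by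
  rw [Tzw_leaderController hs, h2NormSq_eq_sum, ← Fintype.sum_prod_type',
    ← nsmul_eq_mul, ← Finset.sum_const, platoonSupport, Finset.sum_filter]
  refine Finset.sum_congr rfl fun p _ => ?_
  have hst := hA _ h.mul_one_sub_mem
  simp only [Matrix.neg_apply, Matrix.smul_apply, smul_eq_mul]
  rw [platoonT_zero_apply]
  split_ifs with h1 h2 <;> simp_all [scalarH2_neg]

end Leader

/-- Every nonzero entry of the platoon's matrix extracts a scalar loop parameter from a stabilizing
controller. -/
theorem Stabilizes.exists_isLoopParameter {n : ℕ} {Gp : RatFunc ℝ} {A : Subring (RatFunc ℝ)}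
    (hA : ∀ f ∈ A, IsStable f) (hC : ∀ c, RatFunc.C c ∈ A)
    {K : Matrix (Fin n) (Fin n) (RatFunc ℝ)} (hK : Stabilizes A (Gp • platoonT n 0) K)
    {i j : Fin n} (hij : platoonT n 0 i j ≠ 0) :
    ∃ r, IsLoopParameter A Gp r ∧
      scalarH2 (Gp * (1 - Gp * r)) = scalarH2 (Tzw (Gp • platoonT n 0) K i j) := by
  set T := platoonT n 0
  obtain ⟨hu, hst⟩ := hK
  set D := (1 + (Gp • T) * K)⁻¹ with hD
  have hTA : T ∈ A.matrix := platoonT_zero_mem hC n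
  have h11 : Tzw (Gp • T) K ∈ A.matrix := fun i j => hst (.inl i) (.inl j)
  have h21 : -(K * D * (Gp • T)) ∈ A.matrix := fun i j => hst (.inr i) (.inl j)
  have h22 : K * D ∈ A.matrix := fun i j => hst (.inr i) (.inr j)
  have hDe : D = 1 - Gp • (T * (K * D)) := by
    have h1 : (1 + (Gp • T) * K) * D = 1 :=
      Matrix.mul_nonsing_inv _ ((Matrix.isUnit_iff_isUnit_det _).1 hu)
    rw [add_mul, one_mul, Matrix.smul_mul, Matrix.smul_mul, Matrix.mul_assoc] at h1
    exact eq_sub_of_add_eq h1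
  have hTz : Tzw (Gp • T) K = -(Gp • (T - Gp • (T * (K * D) * T))) := by
    rw [Tzw, ← hD]
    conv_lhs => rw [hDe]
    rw [Matrix.mul_smul, sub_mul, one_mul, Matrix.smul_mul]
  have hR : T * (K * D) * T ∈ A.matrix := mul_mem (mul_mem hTA h22) hTA
  have hGR : Gp • (T * (K * D) * T) ∈ A.matrix := by
    have := mul_mem hTA (neg_mem h21)
    rwa [neg_neg, Matrix.mul_smul, Matrix.mul_smul, ← Matrix.mul_assoc] at this
  have htt : T i j * T i j = 1 := platoonT_zero_mul_self_of_ne_zero hij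
  set a := T i j
  set b := (T * (K * D) * T) i j
  have hz : Tzw (Gp • T) K i j = -(Gp * (a - Gp * b)) := by
    rw [hTz]; rfl
  have hzA : Tzw (Gp • T) K i j ∈ A := h11 i j
  have hbA : b ∈ A := hR i j
  have hGb : Gp * b ∈ A := hGR i j
  have haA : a ∈ A := hTA i j
  -- Multiplying the entry by `a` and using `a² = 1` turns it into the scalar loop with parameter `a
  -- * b`.
  have heq : Gp * (1 - Gp * (a * b)) = -(a * Tzw (Gp • T) K i j) := by
    rw [hz]; linear_combination (-Gp) * htt
  refine ⟨a * b, ⟨A.mul_mem haA hbA, ?_, ?_⟩, ?_⟩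
  · rw [mul_left_comm]; exact A.mul_mem haA hGb
  · rw [heq]; exact A.neg_mem (A.mul_mem haA hzA)
  · rw [heq]
    rcases mul_self_eq_one_iff.1 htt with h | h
    · rw [h, one_mul, scalarH2_neg (hA _ hzA)]
    · rw [h, neg_one_mul, neg_neg]

/-- A loop parameter with `1 - Gp r = 0` is a limit of loop parameters whose loops are
well posed. -/
theorem IsLoopParameter.exists_perturbation {A : Subring (RatFunc ℝ)} {Gp r : RatFunc ℝ}
    (hA : ∀ f ∈ A, IsStable f) (hC : ∀ c, RatFunc.C c ∈ A)
    (hX : (RatFunc.X + 1 : RatFunc ℝ)⁻¹ ∈ A) (h : IsLoopParameter A Gp r)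
    (hs : 1 - Gp * r = 0) {δ : ℝ≥0∞} (hδ : δ ≠ 0) :
    ∃ r', IsLoopParameter A Gp r' ∧ 1 - Gp * r' ≠ 0 ∧ scalarH2 (Gp * (1 - Gp * r')) ≤ δ := by
  have hGr : Gp * r = 1 := (sub_eq_zero.1 hs).symm
  set e : RatFunc ℝ := (RatFunc.X + 1)⁻¹ with he
  have htop : scalarH2 e ≠ ∞ := scalarH2_inv_X_add_one_ne_top (hA _ hX)
  obtain ⟨c, hc, hcδ⟩ : ∃ c : ℝ, c ≠ 0 ∧ ‖c‖ₑ ^ 2 * scalarH2 e ≤ δ := by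
    have hlim : Filter.Tendsto (fun c : ℝ => ‖c‖ₑ ^ 2 * scalarH2 e) (nhdsWithin 0 {0}ᶜ)
        (nhds 0) := by
      have h1 : Filter.Tendsto (fun c : ℝ => ‖c‖ₑ ^ 2 * scalarH2 e) (nhds 0)
          (nhds (‖(0 : ℝ)‖ₑ ^ 2 * scalarH2 e)) :=
        ENNReal.Tendsto.mul_const (((ENNReal.continuous_pow 2).comp continuous_enorm).tendsto 0) (.inr htop)
      simpa using h1.mono_left nhdsWithin_le_nhds
    obtain ⟨c, hc, hc0⟩ := ((hlim.eventually_le_const (pos_iff_ne_zero.2 hδ)).and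
      self_mem_nhdsWithin).exists
    exact ⟨c, hc0, hc⟩
  have hX0 : e ≠ 0 := by
    rw [he]
    refine inv_ne_zero ?_
    have : (RatFunc.X + 1 : RatFunc ℝ) = algebraMap (Polynomial ℝ) _ (Polynomial.X + 1) := by
      simp [RatFunc.algebraMap_X]
    rw [this]
    exact RatFunc.algebraMap_ne_zero (Polynomial.X_add_C_ne_zero 1)
  have hr0 : r ≠ 0 := right_ne_zero_of_mul_eq_one hGr
  have hcr : RatFunc.C c ≠ 0 := by simpa using hc
  -- Since `Gp r = 1`, subtracting `c e r²` from `r` leaves `1 - Gp r' = c e r`, which is nonzero.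
  -- Multiplying by `Gp` again gives `c e`, whose norm is finite and tends to `0` with `c`.
  have h1 : Gp * (r - RatFunc.C c * e * r * r) = 1 - RatFunc.C c * e * r := by
    linear_combination (1 - RatFunc.C c * e * r) * hGr
  have h2 : 1 - Gp * (r - RatFunc.C c * e * r * r) = RatFunc.C c * e * r := by
    rw [h1]; ring
  have h3 : Gp * (1 - Gp * (r - RatFunc.C c * e * r * r)) = RatFunc.C c * e := by
    rw [h2]; linear_combination RatFunc.C c * e * hGr
  have hce : RatFunc.C c * e ∈ A := A.mul_mem (hC c) hX
  refine ⟨r - RatFunc.C c * e * r * r, ⟨?_, ?_, ?_⟩, ?_, ?_⟩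
  · exact A.sub_mem h.mem (A.mul_mem (A.mul_mem hce h.mem) h.mem)
  · rw [h1]; exact A.sub_mem A.one_mem (A.mul_mem hce h.mem)
  · rw [h3]; exact hce
  · rw [h2]; exact mul_ne_zero (mul_ne_zero hcr hX0) hr0
  · rw [h3, scalarH2_C_mul (hA _ hX)]; exact hcδ

/-- `T_zw` is a product of invertible matrices up to sign. The cost of `K` is therefore positive,
which leaves room for the perturbation. -/
theorem Stabilizes.Tzw_ne_zero {n : ℕ} (hn : 1 ≤ n) {Gp : RatFunc ℝ} (hG : Gp ≠ 0)
    {S : Set (RatFunc ℝ)} {K : Matrix (Fin n) (Fin n) (RatFunc ℝ)}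
    (hK : Stabilizes S (Gp • platoonT n 0) K) : Tzw (Gp • platoonT n 0) K ≠ 0 := by
  have : Nonempty (Fin n) := ⟨⟨0, hn⟩⟩
  have h1 : IsUnit ((1 + (Gp • platoonT n 0) * K)⁻¹) := Matrix.isUnit_nonsing_inv_iff.2 hK.1
  have h2 : IsUnit (Gp • platoonT n 0) := (isUnit_platoonT_zero n).smul (Units.mk0 Gp hG)
  exact (h1.mul h2).neg.ne_zero

theorem h2NormSq_ne_zero {p q : Type*} [Fintype p] [Fintype q] {B : Matrix p q (RatFunc ℝ)}
    (hB : B ≠ 0) : h2NormSq B ≠ 0 := by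
  contrapose! hB
  rw [h2NormSq_eq_sum] at hB
  ext i j
  by_contra h
  simp only [Finset.sum_eq_zero_iff, Finset.mem_univ, true_imp_iff] at hB
  exact scalarH2_ne_zero h (hB i j)

/-- Every stabilizing controller is matched or beaten by a leader information controller with
scalar parameter. -/
theorem Stabilizes.exists_leaderController_le {n : ℕ} (hn : 1 ≤ n) {Gp : RatFunc ℝ}
    {A : Subring (RatFunc ℝ)} (hA : ∀ f ∈ A, IsStable f) (hC : ∀ c, RatFunc.C c ∈ A)
    (hX : (RatFunc.X + 1 : RatFunc ℝ)⁻¹ ∈ A)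
    {K : Matrix (Fin n) (Fin n) (RatFunc ℝ)} (hK : Stabilizes A (Gp • platoonT n 0) K) :
    ∃ r, IsLoopParameter A Gp r ∧ 1 - Gp * r ≠ 0 ∧
      (platoonSupport n).card * scalarH2 (Gp * (1 - Gp * r)) ≤
        h2NormSq (Tzw (Gp • platoonT n 0) K) := by
  obtain ⟨p, hp, hmin⟩ := (platoonSupport n).exists_min_image
    (fun p => scalarH2 (Tzw (Gp • platoonT n 0) K p.1 p.2)) (platoonSupport_nonempty hn)
  obtain ⟨r, hr, hcost⟩ := hK.exists_isLoopParameter hA hC (mem_platoonSupport.1 hp)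
  by_cases hs : 1 - Gp * r = 0
  · have hG : Gp ≠ 0 := by
      rintro rfl
      simp at hs
    -- The selected entry costs nothing here, but `K` as a whole does not. The perturbation may
    -- spend `J(K)` divided by the number of nonzero entries of `T`.
    have hJ := h2NormSq_ne_zero (hK.Tzw_ne_zero hn hG)
    have hcard : ((platoonSupport n).card : ℝ≥0∞) ≠ ∞ := ENNReal.natCast_ne_top _
    obtain ⟨r', hr', hs', hle⟩ := hr.exists_perturbation hA hC hX hs
      (ENNReal.div_ne_zero.2 ⟨hJ, hcard⟩)
    exact ⟨r', hr', hs', (mul_le_mul_right hle _).trans ENNReal.mul_div_le⟩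
  · refine ⟨r, hr, hs, le_trans ?_ (sum_platoonSupport_le _)⟩
    rw [hcost, ← nsmul_eq_mul]
    exact Finset.card_nsmul_le_sum _ _ _ hmin

/-! ### Youla parameters -/

namespace Factors.IsDoublyCoprime

theorem bezout_eqs {R : Type*} [Ring R] {P : R → Prop} {G : R} {F : Factors R}
    (h : F.IsDoublyCoprime P G) :
    F.Nt * F.Xt + F.Mt * F.Yt = 1 ∧ F.Mt * F.N = F.Nt * F.M ∧
      F.X * F.Yt = F.Y * F.Xt ∧ F.Y * F.M + F.X * F.N = 1 := by
  have hb := h.bezout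
  rw [Matrix.mul_fin_two, Matrix.one_fin_two] at hb
  have h00 := congrFun (congrFun hb 0) 0
  have h01 := congrFun (congrFun hb 0) 1
  have h10 := congrFun (congrFun hb 1) 0
  have h11 := congrFun (congrFun hb 1) 1
  simp only [Matrix.of_apply, Matrix.cons_val', Matrix.cons_val_zero, Matrix.cons_val_one,
    Matrix.cons_val_fin_one, neg_mul, mul_neg, neg_neg] at h00 h01 h10 h11
  refine ⟨h00, ?_, ?_, h11⟩
  · rwa [neg_add_eq_zero, eq_comm] at h01
  · rwa [neg_add_eq_zero, eq_comm] at h10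

section Scalar

variable {A : Subring (RatFunc ℝ)} {Gp : RatFunc ℝ} {F : Factors (RatFunc ℝ)}
  (h : F.IsDoublyCoprime (fun f => f ∈ A) Gp)
include h

/-- Since `Mt ≠ 0`, this identifies well-posedness of the decoupled loop with the condition `Yt - N
q ≠ 0` for the Youla controller. -/
theorem one_sub_mul_param (q : RatFunc ℝ) :
    1 - Gp * ((F.Xt + F.M * q) * F.Mt) = (F.Yt - F.N * q) * F.Mt := by
  obtain ⟨h1, _, _, _⟩ := h.bezout_eqs
  have hr := h.right_fac
  have hl := h.left_fac
  linear_combination -h1 - F.Xt * hl - F.Mt * q * hr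

theorem mul_one_sub_mul_param (q : RatFunc ℝ) :
    Gp * (1 - Gp * ((F.Xt + F.M * q) * F.Mt)) = F.Yt * F.Nt - F.N * q * F.Nt := by
  rw [h.one_sub_mul_param]
  linear_combination (F.Yt - F.N * q) * h.left_fac

theorem scalarCost_eq (q : RatFunc ℝ) :
    scalarCost F q = scalarH2 (Gp * (1 - Gp * ((F.Xt + F.M * q) * F.Mt))) := by
  rw [h.mul_one_sub_mul_param]; rfl

theorem isLoopParameter {q : RatFunc ℝ} (hq : q ∈ A) :
    IsLoopParameter A Gp ((F.Xt + F.M * q) * F.Mt) where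
  mem := A.mul_mem (A.add_mem h.stable_Xt (A.mul_mem h.stable_M hq)) h.stable_Mt
  mul_mem := by
    rw [mul_left_comm, mul_comm Gp, h.left_fac]
    exact A.mul_mem (A.add_mem h.stable_Xt (A.mul_mem h.stable_M hq)) h.stable_Nt
  mul_one_sub_mem := by
    rw [h.mul_one_sub_mul_param]
    exact A.sub_mem (A.mul_mem h.stable_Yt h.stable_Nt)
      (A.mul_mem (A.mul_mem h.stable_N hq) h.stable_Nt)

/-- By Bézout, `M⁻¹ = Y + X Gp` and `Mt⁻¹ = Yt + Gp Xt`. Solving for `q` and expanding gives a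
stable combination of `d`, `Gp d` and `Gp² d`, where `d = r - Xt Mt`. The three conditions on a loop
parameter are what make these three stable. -/
theorem exists_eq_param {r : RatFunc ℝ} (hr : IsLoopParameter A Gp r) :
    ∃ q ∈ A, r = (F.Xt + F.M * q) * F.Mt := by
  obtain ⟨h1, h2, h3, h4⟩ := h.bezout_eqs
  have hR := h.right_fac
  have hL := h.left_fac
  have e1 : (Gp * Gp) * (r - F.Xt * F.Mt) = F.Yt * F.Nt - Gp * (1 - Gp * r) := by
    linear_combination (-Gp * F.Xt + F.Yt) * hL - Gp * h1
  have e2 : Gp * (r - F.Xt * F.Mt) = Gp * r - F.Xt * F.Nt := by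
    linear_combination (-F.Xt) * hL
  have m0 : r - F.Xt * F.Mt ∈ A := A.sub_mem hr.mem (A.mul_mem h.stable_Xt h.stable_Mt)
  have m1 : Gp * (r - F.Xt * F.Mt) ∈ A := by
    rw [e2]; exact A.sub_mem hr.mul_mem (A.mul_mem h.stable_Xt h.stable_Nt)
  have m2 : (Gp * Gp) * (r - F.Xt * F.Mt) ∈ A := by
    rw [e1]; exact A.sub_mem (A.mul_mem h.stable_Yt h.stable_Nt) hr.mul_one_sub_mem
  refine ⟨F.Y * F.Yt * (r - F.Xt * F.Mt) +
    (F.Y * F.Xt + F.X * F.Yt) * (Gp * (r - F.Xt * F.Mt)) +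
    F.X * F.Xt * ((Gp * Gp) * (r - F.Xt * F.Mt)), ?_, ?_⟩
  · exact A.add_mem (A.add_mem (A.mul_mem (A.mul_mem h.stable_Y h.stable_Yt) m0)
      (A.mul_mem (A.add_mem (A.mul_mem h.stable_Y h.stable_Xt)
        (A.mul_mem h.stable_X h.stable_Yt)) m1)) (A.mul_mem (A.mul_mem h.stable_X h.stable_Xt) m2)
  · have e3 : F.M * (F.Y + F.X * Gp) = 1 := by linear_combination h4 + F.X * hR
    have e4 : F.Mt * (F.Yt + Gp * F.Xt) = 1 := by linear_combination h1 + F.Xt * hL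
    linear_combination (-(r - F.Xt * F.Mt)) * (e3 * (F.Mt * (F.Yt + Gp * F.Xt)) + e4)

/-- Links the two denominators of the Youla controller: with `M` and `Mt` nonzero, they vanish
together. -/
theorem mul_Y_sub (q : RatFunc ℝ) :
    F.M * (F.Y - q * F.Nt) = F.Mt * (F.Yt - F.N * q) := by
  obtain ⟨h1, h2, h3, h4⟩ := h.bezout_eqs
  have hR := h.right_fac
  have hL := h.left_fac
  have h5 : F.M * (F.Y + F.X * Gp) = 1 := by linear_combination h4 + F.X * hR
  have h7 : F.Mt * (F.Yt + Gp * F.Xt) = 1 := by linear_combination h1 + F.Xt * hL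
  have h6 : F.M * F.Y = F.Mt * F.Yt := by
    linear_combination (F.Mt * F.Yt) * h5 - (F.M * F.Y) * h7 - F.M * F.Mt * Gp * h3
  linear_combination h6 + q * h2

/-- In every block product `T` meets `T⁻¹` or only scalar matrices occur, so the four blocks of the
Bézout identity are the scalar identities times `I`. -/
theorem platoonFactors {n : ℕ} (hC : ∀ c, RatFunc.C c ∈ A) :
    (platoonFactors n 0 (fun _ => 1) F).IsDoublyCoprime (fun B => ∀ i j, B i j ∈ A)
      (Gp • platoonT n 0) := by
  have hsmul {a : RatFunc ℝ} (ha : a ∈ A) {B : Matrix (Fin n) (Fin n) (RatFunc ℝ)}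
      (hB : B ∈ A.matrix) : ∀ i j, (a • B) i j ∈ A := fun i j => A.mul_mem ha (hB i j)
  have hT := platoonT_zero_mem hC n
  have hT' := platoonT_zero_inv_mem hC n
  have h1 : (1 : Matrix (Fin n) (Fin n) (RatFunc ℝ)) ∈ A.matrix := one_mem _
  have hTu := isUnit_platoonT_zero n
  obtain ⟨b1, b2, b3, b4⟩ := h.bezout_eqs
  rw [platoonFactors_zero_one]
  refine ⟨hsmul h.stable_M hT', hsmul h.stable_N h1, hsmul h.stable_Mt h1, hsmul h.stable_Nt hT,
    hsmul h.stable_X h1, hsmul h.stable_Y hT, hsmul h.stable_Xt hT', hsmul h.stable_Yt h1,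
    ?_, ?_, ?_, ?_, ?_⟩
  · exact (Matrix.isUnit_nonsing_inv_iff.2 hTu).smul h.isUnit_M.unit
  · exact isUnit_one.smul h.isUnit_Mt.unit
  · simp only [Matrix.smul_mul, Matrix.mul_smul, platoonT_zero_mul_inv, smul_smul]
    rw [mul_comm, h.right_fac]
  · simp only [Matrix.smul_mul, Matrix.mul_smul, one_mul, smul_smul]
    rw [mul_comm Gp, mul_comm F.Mt, mul_comm Gp, h.left_fac]
  · rw [Matrix.mul_fin_two, Matrix.one_fin_two]
    simp only [Matrix.smul_mul, Matrix.mul_smul, platoonT_zero_mul_inv, smul_smul,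
      mul_one, neg_mul, mul_neg, neg_neg, ← add_smul, ← neg_smul]
    have e1 : F.Xt * F.Nt + F.Yt * F.Mt = 1 := by linear_combination b1
    have e2 : -(F.M * F.Nt) + F.N * F.Mt = 0 := by linear_combination b2
    have e3 : -(F.Xt * F.Y) + F.Yt * F.X = 0 := by linear_combination b3
    have e4 : F.M * F.Y + F.N * F.X = 1 := by linear_combination b4
    rw [e1, e2, e3, e4, one_smul, zero_smul]

/-- With `r = (Xt + M q)Mt` and `1 - Gp r = (Yt - N q)Mt`, the factor `Mt` cancels in `r / (1 - Gp
r)`, leaving the right Youla quotient. -/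
theorem isYoulaController {n : ℕ} {q : RatFunc ℝ} (hq : F.Yt - F.N * q ≠ 0) :
    (_root_.platoonFactors n 0 (fun _ => 1) F).IsYoulaController (Matrix.diagonal fun _ => q)
      (leaderController n Gp ((F.Xt + F.M * q) * F.Mt)) := by
  have hTu := isUnit_platoonT_zero n
  have hMt : F.Mt ≠ 0 := h.isUnit_Mt.ne_zero
  have hYM := h.mul_Y_sub q
  have hY : F.Y - q * F.Nt ≠ 0 := fun h0 => by
    rw [h0, mul_zero, eq_comm] at hYM
    exact mul_ne_zero hMt hq hYM
  obtain ⟨b1, b2, b3, b4⟩ := h.bezout_eqs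
  have hinv {a : RatFunc ℝ} (ha : a ≠ 0) {B C : Matrix (Fin n) (Fin n) (RatFunc ℝ)}
      (hBC : B * C = 1) : (a • B)⁻¹ = a⁻¹ • C := by
    apply Matrix.inv_eq_right_inv
    rw [Matrix.smul_mul, Matrix.mul_smul, smul_smul, mul_inv_cancel₀ ha, one_smul, hBC]
  have hQ : (Matrix.diagonal fun _ => q : Matrix (Fin n) (Fin n) (RatFunc ℝ)) = q • 1 :=
    (Matrix.smul_one_eq_diagonal q).symm
  rw [platoonFactors_zero_one, Factors.IsYoulaController, hQ, leaderController,
    h.one_sub_mul_param, mul_div_mul_right _ _ hMt]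
  simp only [Matrix.smul_mul, Matrix.mul_smul, one_mul, mul_one, smul_smul, ← sub_smul, ← add_smul]
  rw [mul_comm F.Nt q, mul_comm q F.N, hinv hY (platoonT_zero_mul_inv n), hinv hq (one_mul 1)]
  refine ⟨hTu.smul (Units.mk0 _ hY), isUnit_one.smul (Units.mk0 _ hq), ?_, ?_⟩
  · rw [smul_smul, ← div_eq_mul_inv]
    congr 1
    -- After cross-multiplication, the coefficients of `1`, `q` and `q²` agree by the four Bézout
    -- relations.
    rw [div_eq_div_iff hq hY]
    linear_combination q * (b4 - b1) - b3 + q ^ 2 * b2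
  · rw [Matrix.mul_smul, mul_one, smul_smul, ← div_eq_mul_inv, mul_comm q F.M]

end Scalar

end Factors.IsDoublyCoprime

/-- Here `S` is the set of stable transfer functions, under either convention on poles at infinity;
`Yt - N q ≠ 0` says that the controller with Youla parameter `diag(q, …, q)` is defined. -/
theorem mainTheorem5 (n : ℕ) (hn : 1 ≤ n)
    (S : Set (RatFunc ℝ)) (hS : S = stableTF ∨ S = properStableTF)
    (Gp : RatFunc ℝ) (hGp : IsStrictlyProper Gp)
    (G : Matrix (Fin n) (Fin n) (RatFunc ℝ))
    (hG : G = platoonPlant n 0 (fun _ => 1) Gp) :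
    -- every stabilizing controller is matched or beaten by a leader information controller
    (∀ K, Stabilizes S G K →
      ∃ L, IsLeaderInformation S G L ∧ h2NormSq (Tzw G L) ≤ h2NormSq (Tzw G K)) ∧
    -- the two minimization problems have the same infimum
    (⨅ (L) (_ : IsLeaderInformation S G L), h2NormSq (Tzw G L)) =
      (⨅ (K) (_ : Stabilizes S G K), h2NormSq (Tzw G K)) ∧
    -- and the same minimum: each is attained exactly when the other one is, with the same value
    (∀ m : ℝ≥0∞,
      IsLeast ((fun K => h2NormSq (Tzw G K)) '' {K | Stabilizes S G K}) m ↔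
        IsLeast ((fun L => h2NormSq (Tzw G L)) '' {L | IsLeaderInformation S G L}) m) ∧
    -- Youla parameters
    (∀ F : Factors (RatFunc ℝ), F.IsDoublyCoprime (fun f => f ∈ S) Gp →
      (platoonFactors n 0 (fun _ => 1) F).IsDoublyCoprime (fun A => ∀ i j, A i j ∈ S) G ∧
      -- every stable `q` gives a leader information controller; it is optimal among all stabilizing
      -- controllers if and only if `q` solves the scalar model-matching problem
      (∀ q ∈ S, F.Yt - F.N * q ≠ 0 →
        ∃ L, (platoonFactors n 0 (fun _ => 1) F).IsYoulaController (Matrix.diagonal fun _ => q) L ∧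
          IsLeaderInformation S G L ∧
          ((∀ K, Stabilizes S G K → h2NormSq (Tzw G L) ≤ h2NormSq (Tzw G K)) ↔
            ∀ q' ∈ S, F.Yt - F.N * q' ≠ 0 → scalarCost F q ≤ scalarCost F q')) ∧
      -- every stabilizing controller is matched or beaten by a controller of this kind
      (∀ K, Stabilizes S G K →
        ∃ q ∈ S, ∃ L,
          (platoonFactors n 0 (fun _ => 1) F).IsYoulaController (Matrix.diagonal fun _ => q) L ∧
          IsLeaderInformation S G L ∧ h2NormSq (Tzw G L) ≤ h2NormSq (Tzw G K)) ∧
      -- if the minimum over all stabilizing controllers exists, it is attained by one of this kind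
      (∀ m : ℝ≥0∞,
        IsLeast ((fun K => h2NormSq (Tzw G K)) '' {K | Stabilizes S G K}) m →
        ∃ q ∈ S, ∃ L,
          (platoonFactors n 0 (fun _ => 1) F).IsYoulaController (Matrix.diagonal fun _ => q) L ∧
          IsLeaderInformation S G L ∧ h2NormSq (Tzw G L) = m)) := by
  obtain ⟨A, rfl, hA, hC, hX⟩ := exists_subring_of_stable hS
  rw [platoonPlant_zero_one] at hG
  subst hG
  have hle (K : Matrix (Fin n) (Fin n) (RatFunc ℝ)) (hK : Stabilizes A (Gp • platoonT n 0) K) :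
      ∃ L, IsLeaderInformation A (Gp • platoonT n 0) L ∧
        h2NormSq (Tzw (Gp • platoonT n 0) L) ≤ h2NormSq (Tzw (Gp • platoonT n 0) K) := by
    obtain ⟨r, hr, hs, h⟩ := hK.exists_leaderController_le hn hA hC hX
    exact ⟨_, hr.isLeaderInformation hC hs, (h2NormSq_Tzw_leaderController hA hr hs).trans_le h⟩
  refine ⟨hle, ?_, ?_, ?_⟩
  · apply le_antisymm
    · refine le_iInf₂ fun K hK => ?_
      obtain ⟨L, hL, h⟩ := hle K hK
      exact (iInf₂_le L hL).trans h
    · exact le_iInf₂ fun L hL => iInf₂_le L hL.1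
  · intro m
    constructor
    · rintro ⟨⟨K, hK, rfl⟩, hm⟩
      obtain ⟨L, hL, h⟩ := hle K hK
      refine ⟨⟨L, hL, le_antisymm h (hm ⟨L, hL.1, rfl⟩)⟩, ?_⟩
      rintro _ ⟨L', hL', rfl⟩
      exact hm ⟨L', hL'.1, rfl⟩
    · rintro ⟨⟨L, hL, rfl⟩, hm⟩
      refine ⟨⟨L, hL.1, rfl⟩, ?_⟩
      rintro _ ⟨K, hK, rfl⟩
      obtain ⟨L', hL', h⟩ := hle K hK
      exact (hm ⟨L', hL', rfl⟩).trans h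
  · intro F hF
    have hMt : F.Mt ≠ 0 := hF.isUnit_Mt.ne_zero
    have hs {q : RatFunc ℝ} :
        1 - Gp * ((F.Xt + F.M * q) * F.Mt) ≠ 0 ↔ F.Yt - F.N * q ≠ 0 := by
      rw [hF.one_sub_mul_param]
      simp [hMt]
    have hlead {q : RatFunc ℝ} (hq : q ∈ A) (hqY : F.Yt - F.N * q ≠ 0) :
        IsLeaderInformation A (Gp • platoonT n 0)
          (leaderController n Gp ((F.Xt + F.M * q) * F.Mt)) :=
      (hF.isLoopParameter hq).isLeaderInformation hC (hs.2 hqY)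
    have hcost {q : RatFunc ℝ} (hq : q ∈ A) (hqY : F.Yt - F.N * q ≠ 0) :
        h2NormSq (Tzw (Gp • platoonT n 0)
          (leaderController n Gp ((F.Xt + F.M * q) * F.Mt))) =
          (platoonSupport n).card * scalarCost F q := by
      rw [h2NormSq_Tzw_leaderController hA (hF.isLoopParameter hq) (hs.2 hqY), hF.scalarCost_eq]
    have hbeat (K : Matrix (Fin n) (Fin n) (RatFunc ℝ))
        (hK : Stabilizes A (Gp • platoonT n 0) K) :
        ∃ q ∈ A, F.Yt - F.N * q ≠ 0 ∧ (platoonSupport n).card * scalarCost F q ≤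
          h2NormSq (Tzw (Gp • platoonT n 0) K) := by
      obtain ⟨r, hr, hs', h⟩ := hK.exists_leaderController_le hn hA hC hX
      obtain ⟨q, hq, rfl⟩ := hF.exists_eq_param hr
      exact ⟨q, hq, hs.1 hs', by rwa [hF.scalarCost_eq]⟩
    -- The common factor must be nonzero and finite to be cancelled in `ℝ≥0∞`, where the costs
    -- themselves may be infinite.
    have hcard : ((platoonSupport n).card : ℝ≥0∞) ≠ 0 :=
      Nat.cast_ne_zero.2 (platoonSupport_nonempty hn).card_pos.ne'
    have hcard' : ((platoonSupport n).card : ℝ≥0∞) ≠ ∞ := ENNReal.natCast_ne_top _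
    refine ⟨hF.platoonFactors hC, fun q hq hqY => ⟨_, hF.isYoulaController hqY, hlead hq hqY, ?_⟩,
      fun K hK => ?_, ?_⟩
    · rw [hcost hq hqY]
      constructor
      -- The controller built from `q'` is itself a stabilizing competitor, so optimality over all
      -- `K` can be tested on it.
      · intro h q' hq' hqY'
        have h1 := h _ (hlead hq' hqY').1
        rwa [hcost hq' hqY', ENNReal.mul_le_mul_iff_right hcard hcard'] at h1
      · intro h K hK
        obtain ⟨q', hq', hqY', hK'⟩ := hbeat K hK
        exact (mul_le_mul_right (h q' hq' hqY') _).trans hK'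
    · obtain ⟨q, hq, hqY, h⟩ := hbeat K hK
      exact ⟨q, hq, _, hF.isYoulaController hqY, hlead hq hqY, (hcost hq hqY).trans_le h⟩
    · rintro m ⟨⟨K, hK, rfl⟩, hm⟩
      obtain ⟨q, hq, hqY, h⟩ := hbeat K hK
      exact ⟨q, hq, _, hF.isYoulaController hqY, hlead hq hqY,
        le_antisymm ((hcost hq hqY).trans_le h) (hm ⟨_, (hlead hq hqY).1, rfl⟩)⟩
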